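/- Let $(r_k)_{k\ge 0}$ be a real sequence that is a covariance series, i.e. $\sum_{i,j=0}^m u_iu_j\,r_{|j-i|}\ge 0$ for all $m\in\mathbb N$ and all real $u_0,\dots,u_m$, and let $n\in\mathbb N$ be such that the infinite Hankel matrix $(r_{i+j+1})_{i,j\ge 0}$ has finite rank at most $n$ (equivalently, $r_k=HF^{k-1}N$ for all $k\ge 1$, for some real matrices $H,F,N$ of sizes $1\times n$, $n\times n$, $n\times 1$). Then $(r_k)$ is realized by a stationary linear and Gaussian generative unified model (GUM) of dimension $n$ (in particular by one whose dimension is the rank of the Hankel matrix). That is, there are $a\in\mathbb R^{n\times n}$, $b\in\mathbb R^{1\times n}$, $c\in\mathbb R^{n\times 1}$, symmetric positive semidefinite $\alpha,\eta\in\mathbb R^{n\times n}$ and $\beta\ge 0$ such that the process $(h_t,x_t)_{t\ge 0}$ with values in $\mathbb R^n\times\mathbb R$ whose law is given, for all $t$, by $$p(h_{0:t},x_{0:t})=p(h_0)\prod_{s=1}^t p(h_s\mid h_{s-1},x_{s-1})\prod_{s=0}^t p(x_s\mid h_s),$$ $$p(h_0)=\mathcal N(0,\eta),\qquad p(h_s\mid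 h_{s-1},x_{s-1})=\mathcal N(ah_{s-1}+cx_{s-1},\alpha),\qquad p(x_s\mid h_s)=\mathcal N(bh_s,\beta)$$ (possibly degenerate Gaussian laws) satisfies: 1. (stationarity) $h_t$ has covariance matrix $\eta$ for every $t\ge 0$; 2. (realization) every $x_t$ is square integrable and $\operatorname{Cov}(x_t,x_{t+k})=r_k$ for all $t,k\ge 0$; 3. if moreover $r_k\to 0$ as $k\to\infty$, then all the eigenvalues of $a+cb$ lie in the open unit disc. -/

import Mathlib

open MeasureTheory ProbabilityTheory Filter Topology
open scoped Matrix NNReal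

noncomputable section

/-- `(r k)` is a covariance series: all the Toeplitz forms `∑ u i * u j * r |j - i|`,
`0 ≤ i, j ≤ m`, are nonnegative. -/
def IsCovarianceSeries (r : ℕ → ℝ) : Prop :=
  ∀ (m : ℕ) (u : ℕ → ℝ),
    0 ≤ ∑ i ∈ Finset.range (m + 1), ∑ j ∈ Finset.range (m + 1),
      u i * u j * r ((j : ℤ) - (i : ℤ)).natAbs

/-- The doubly infinite Hankel matrix of `r 1, r 2, r 3, …`. -/
def hankelMatrix (r : ℕ → ℝ) : Matrix ℕ ℕ ℝ :=
  Matrix.of fun i j => r (i + j + 1)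

/-- The parameters `(a, b, c, α, β, η)` of a linear and Gaussian generative unified model with
`n`-dimensional latent variables and scalar observations. -/
structure LinearGaussianGUM (n : ℕ) where
  a : Matrix (Fin n) (Fin n) ℝ
  b : Fin n → ℝ
  c : Fin n → ℝ
  α : Matrix (Fin n) (Fin n) ℝ
  β : ℝ≥0
  η : Matrix (Fin n) (Fin n) ℝ
  posSemidef_α : α.PosSemidef
  posSemidef_η : η.PosSemidef

section

open scoped MatrixOrder

theorem measurable_multivariateGaussian_mean {n : ℕ} (S : Matrix (Fin n) (Fin n) ℝ) :
    Measurable fun m : EuclideanSpace ℝ (Fin n) => multivariateGaussian m S := by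
  refine Measure.measurable_of_measurable_coe _ fun s hs => ?_
  have h : Measurable fun p : EuclideanSpace ℝ (Fin n) × EuclideanSpace ℝ (Fin n) =>
      p.1 + Matrix.toEuclideanCLM (𝕜 := ℝ) (CFC.sqrt S) p.2 := by fun_prop
  have h2 := measurable_measure_prodMk_left
    (ν := stdGaussian (EuclideanSpace ℝ (Fin n))) (h hs)
  convert h2 using 2 with m
  rw [multivariateGaussian, Measure.map_apply (by fun_prop) hs]
  rfl

end

namespace LinearGaussianGUM

variable {n : ℕ} (θ : LinearGaussianGUM n)

/-- `p(x_t | h_t) = N(b h_t, β)`. -/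
def emission : Kernel (EuclideanSpace ℝ (Fin n)) ℝ where
  toFun h := gaussianReal (θ.b ⬝ᵥ h) θ.β
  measurable' := by
    have h1 : Measurable fun h : EuclideanSpace ℝ (Fin n) => θ.b ⬝ᵥ h := by
      unfold dotProduct; fun_prop
    exact measurable_gaussianReal.comp (h1.prodMk measurable_const)

/-- `p(h_t | h_{t-1}, x_{t-1}) = N(a h_{t-1} + c x_{t-1}, α)`. -/
def transition : Kernel (EuclideanSpace ℝ (Fin n) × ℝ) (EuclideanSpace ℝ (Fin n)) where
  toFun p := multivariateGaussian (WithLp.toLp 2 (θ.a *ᵥ p.1 + p.2 • θ.c)) θ.α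
  measurable' := by
    refine (measurable_multivariateGaussian_mean θ.α).comp ?_
    refine (WithLp.measurable_toLp 2 (Fin n → ℝ)).comp (measurable_pi_lambda _ fun i => ?_)
    simp only [Pi.add_apply, Pi.smul_apply, Matrix.mulVec, dotProduct, smul_eq_mul]
    fun_prop

instance : IsMarkovKernel θ.emission :=
  ⟨fun h => inferInstanceAs (IsProbabilityMeasure (gaussianReal (θ.b ⬝ᵥ h) θ.β))⟩

instance : IsMarkovKernel θ.transition :=
  ⟨fun p => inferInstanceAs (IsProbabilityMeasure
    (multivariateGaussian (WithLp.toLp 2 (θ.a *ᵥ p.1 + p.2 • θ.c)) θ.α))⟩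

/-- `p(h_t, x_t | h_{t-1}, x_{t-1}) = p(h_t | h_{t-1}, x_{t-1}) p(x_t | h_t)`. -/
def step : Kernel (EuclideanSpace ℝ (Fin n) × ℝ) (EuclideanSpace ℝ (Fin n) × ℝ) :=
  θ.transition ⊗ₖ θ.emission.comap Prod.snd measurable_snd

instance : IsMarkovKernel θ.step :=
  inferInstanceAs (IsMarkovKernel (θ.transition ⊗ₖ θ.emission.comap Prod.snd measurable_snd))

/-- `p(h_0, x_0) = p(h_0) p(x_0 | h_0)` with `p(h_0) = N(0, η)`. -/
def init : Measure (EuclideanSpace ℝ (Fin n) × ℝ) :=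
  multivariateGaussian 0 θ.η ⊗ₘ θ.emission

/-- The law of the whole process `(h_t, x_t)`, `t = 0, 1, 2, …`: the probability measure on
trajectories whose marginals are
`p(h_{0:t}, x_{0:t}) = p(h_0) ∏ p(h_s | h_{s-1}, x_{s-1}) ∏ p(x_s | h_s)`. -/
def law : Measure (ℕ → EuclideanSpace ℝ (Fin n) × ℝ) :=
  Kernel.trajMeasure (X := fun _ : ℕ => EuclideanSpace ℝ (Fin n) × ℝ) θ.init
    fun t => θ.step.comap
      (fun past : (i : Finset.Iic t) → EuclideanSpace ℝ (Fin n) × ℝ =>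
        past ⟨t, Finset.mem_Iic.2 le_rfl⟩)
      (measurable_pi_apply _)

/-- The latent variable `h_t` on the space of trajectories. -/
def latent (n t : ℕ) (ω : ℕ → EuclideanSpace ℝ (Fin n) × ℝ) : EuclideanSpace ℝ (Fin n) :=
  (ω t).1

/-- The observation `x_t` on the space of trajectories. -/
def observation (n t : ℕ) (ω : ℕ → EuclideanSpace ℝ (Fin n) × ℝ) : ℝ :=
  (ω t).2

/-- Stationarity: the covariance matrix of `h_t` is the same matrix `η` for all `t`. -/
def IsStationary : Prop :=
  ∀ (t : ℕ) (i j : Fin n),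
    cov[fun ω => latent n t ω i, fun ω => latent n t ω j; θ.law] = θ.η i j

/-- All the eigenvalues of `a + c b` lie in the open unit disc. -/
def IsStable : Prop :=
  ∀ z ∈ spectrum ℂ ((θ.a + Matrix.vecMulVec θ.c θ.b).map ((↑) : ℝ → ℂ)), ‖z‖ < 1

/-- The model realizes `(r k)`: its observations are square integrable and
`Cov(x_t, x_{t+k}) = r k` for all `t` and `k`. -/
def Realizes (r : ℕ → ℝ) : Prop :=
  (∀ t, MemLp (observation n t) 2 θ.law) ∧
    ∀ t k, cov[observation n t, observation n (t + k); θ.law] = r k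

end LinearGaussianGUM

end

/-! Put `F = a + c b`. Fresh noises are independent of the past, so `Cov(h_t) = η` for all `t` as
soon as `η = F η Fᵀ + β c cᵀ + α`; then `Cov(x_t, h_{t+k+1}) = F^k N` with `N = F η bᵀ + β c`
(`isStationary_and_realizes`). It therefore suffices to find `F`, `b`, `N` with `r (k+1) = b F^k N`
and some `P ⪰ 0` making the block matrix with diagonal blocks `P - F P Fᵀ`, `r 0 - b P bᵀ` and
off-diagonal block `N - F P bᵀ` positive semidefinite. Take `η = P`, let `β` be the scalar corner,
`c = (N - F P bᵀ) / β`, and `α` the Schur complement.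

A linear dependence among `n + 1` columns of the Hankel matrix is a recurrence of order `d ≤ n`; `F`
is its companion matrix padded to size `n`, `b` the first coordinate and `N = (r 1, …, r n)`.

The matrix `P` stands for the covariance of the predictions of the next `n` observations from the
past. Vectors with the Toeplitz matrix as Gram matrix play the observations, and orthogonal
projections the predictions. Projections contract norms, which gives the block inequality with `P`
replaced by the Gram matrices at two successive times (`gram_prediction_le`). Averaging over `T`
times leaves an error `O(1/T)` (`exists_approx`), and a limit point as `T → ∞` is the required `P`
(`exists_stateCovariance`). No infinite past is needed.

For stability, `d` is chosen least: a root of modulus at least one could be divided out of the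
recurrence when `r → 0`, giving a shorter one. -/

/-! ### The model as a recursion driven by independent noises -/

theorem MeasureTheory.Measure.map_compProd_eq_map_prod {X Y Z W : Type*} [MeasurableSpace X]
    [MeasurableSpace Y] [MeasurableSpace Z] [MeasurableSpace W] (μ : Measure X) [SFinite μ]
    (ν : Measure W) [SFinite ν] (κ : Kernel Y Z) [IsSFiniteKernel κ] {g : X → Y}
    (hg : Measurable g) {f : Y → W → Z} (hf : Measurable (Function.uncurry f))
    (h : ∀ y, κ y = ν.map (f y)) :
    μ.map g ⊗ₘ κ = (μ.prod ν).map fun p => (g p.1, f (g p.1) p.2) := by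
  have hf1 : ∀ y, Measurable (f y) := fun y => hf.of_uncurry_left
  have hm : Measurable fun p : X × W => (g p.1, f (g p.1) p.2) :=
    (hg.comp measurable_fst).prodMk (hf.comp ((hg.comp measurable_fst).prodMk measurable_snd))
  ext s hs
  rw [Measure.compProd_apply hs, Measure.map_apply hm hs, Measure.prod_apply (hm hs),
    lintegral_map (Kernel.measurable_kernel_prodMk_left hs) hg]
  refine lintegral_congr fun x => ?_
  rw [h, Measure.map_apply (hf1 _) (measurable_prodMk_left hs)]
  rfl

theorem ProbabilityTheory.multivariateGaussian_eq_map_zero {n : ℕ}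
    (m : EuclideanSpace ℝ (Fin n)) (S : Matrix (Fin n) (Fin n) ℝ) :
    multivariateGaussian m S = (multivariateGaussian 0 S).map (m + ·) := by
  simp only [multivariateGaussian]
  rw [Measure.map_map (by fun_prop) (by fun_prop)]
  congr 1
  ext1 x
  simp

theorem ProbabilityTheory.memLp_eval_multivariateGaussian {n : ℕ}
    (m : EuclideanSpace ℝ (Fin n)) (S : Matrix (Fin n) (Fin n) ℝ) (i : Fin n) :
    MemLp (fun x : EuclideanSpace ℝ (Fin n) => x i) 2 (multivariateGaussian m S) :=
  MemLp.eval_piLp (f := fun x : EuclideanSpace ℝ (Fin n) => x) IsGaussian.memLp_two_id i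

namespace LinearGaussianGUM

variable {n : ℕ} (θ : LinearGaussianGUM n)

/-- The law of the pair of the state noise and the observation noise. -/
noncomputable def noise : Measure (EuclideanSpace ℝ (Fin n) × ℝ) :=
  (multivariateGaussian 0 θ.α).prod (gaussianReal 0 θ.β)

instance : IsProbabilityMeasure θ.noise :=
  inferInstanceAs (IsProbabilityMeasure ((multivariateGaussian 0 θ.α).prod (gaussianReal 0 θ.β)))

instance : IsProbabilityMeasure θ.init :=
  inferInstanceAs (IsProbabilityMeasure (multivariateGaussian 0 θ.η ⊗ₘ θ.emission))

instance : IsProbabilityMeasure θ.law := by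
  unfold law; infer_instance

/-- The mean `a h + c x` of the next latent variable. -/
def drift (z : EuclideanSpace ℝ (Fin n) × ℝ) : EuclideanSpace ℝ (Fin n) :=
  WithLp.toLp 2 (θ.a *ᵥ z.1 + z.2 • θ.c)

/-- The next latent variable and observation as functions of the current ones and the noise. -/
def next (z w : EuclideanSpace ℝ (Fin n) × ℝ) : EuclideanSpace ℝ (Fin n) × ℝ :=
  (θ.drift z + w.1, θ.b ⬝ᵥ (θ.drift z + w.1) + w.2)

@[fun_prop]
theorem measurable_drift : Measurable θ.drift := by
  refine (WithLp.measurable_toLp 2 (Fin n → ℝ)).comp (measurable_pi_lambda _ fun i => ?_)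
  simp only [Pi.add_apply, Pi.smul_apply, Matrix.mulVec, dotProduct, smul_eq_mul]
  fun_prop

@[fun_prop]
theorem measurable_dotProduct_b :
    Measurable fun h : EuclideanSpace ℝ (Fin n) => θ.b ⬝ᵥ h := by
  unfold dotProduct; fun_prop

theorem measurable_next {X : Type*} [MeasurableSpace X]
    {f g : X → EuclideanSpace ℝ (Fin n) × ℝ} (hf : Measurable f) (hg : Measurable g) :
    Measurable fun x => θ.next (f x) (g x) := by
  have h : Measurable fun x => θ.drift (f x) + (g x).1 := by fun_prop
  exact h.prodMk ((θ.measurable_dotProduct_b.comp h).add (by fun_prop))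

theorem emission_eq (h : EuclideanSpace ℝ (Fin n)) :
    θ.emission h = (gaussianReal 0 θ.β).map (θ.b ⬝ᵥ h + ·) := by
  rw [gaussianReal_map_const_add, zero_add]; rfl

theorem compProd_emission (m : EuclideanSpace ℝ (Fin n)) (S : Matrix (Fin n) (Fin n) ℝ) :
    multivariateGaussian m S ⊗ₘ θ.emission =
      ((multivariateGaussian 0 S).prod (gaussianReal 0 θ.β)).map
        fun w => (m + w.1, θ.b ⬝ᵥ (m + w.1) + w.2) := by
  rw [multivariateGaussian_eq_map_zero m]
  exact Measure.map_compProd_eq_map_prod _ _ _ (by fun_prop)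
    (f := fun (h : EuclideanSpace ℝ (Fin n)) v => θ.b ⬝ᵥ h + v)
    (by simp only [Function.uncurry_def]; fun_prop)
    θ.emission_eq

theorem step_eq (z : EuclideanSpace ℝ (Fin n) × ℝ) : θ.step z = θ.noise.map (θ.next z) := by
  have h : θ.step z = multivariateGaussian (θ.drift z) θ.α ⊗ₘ θ.emission := by
    ext s hs
    rw [step, Kernel.compProd_apply hs, Measure.compProd_apply hs]
    rfl
  rw [h, compProd_emission]
  rfl

theorem map_zero_law : θ.law.map (fun ω => ω 0) =
    ((multivariateGaussian 0 θ.η).prod (gaussianReal 0 θ.β)).map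
        fun w => (w.1, θ.b ⬝ᵥ w.1 + w.2) := by
  have h : θ.law.map (fun ω => ω 0) = θ.init := by
    have h0 : (fun ω : ℕ → EuclideanSpace ℝ (Fin n) × ℝ => ω 0) =
      (MeasurableEquiv.piUnique fun _ : Finset.Iic 0 => EuclideanSpace ℝ (Fin n) × ℝ) ∘
        (Preorder.frestrictLe (π := fun _ : ℕ => EuclideanSpace ℝ (Fin n) × ℝ) 0) := rfl
    rw [h0, ← Measure.map_map (by fun_prop) (by fun_prop), law, Kernel.trajMeasure,
      Measure.map_comp _ _ (by fun_prop), Kernel.traj_map_frestrictLe,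
      Kernel.partialTraj_self, Measure.id_comp, Measure.map_map (by fun_prop) (by fun_prop),
      MeasurableEquiv.self_comp_symm, Measure.map_id]
  rw [h, init, compProd_emission]
  simp

/-- The kernel at time `t` sees the past only through its last entry, and each step is the image of
the noise under `next`. Taking the noise independent of the entire trajectory is harmless, since
only coordinates up to `t` are read. -/
theorem map_past_succ_law (t : ℕ) :
    θ.law.map (fun ω =>
      (Preorder.frestrictLe (π := fun _ : ℕ => EuclideanSpace ℝ (Fin n) × ℝ) t ω, ω (t + 1))) =
    (θ.law.prod θ.noise).map fun p =>
      (Preorder.frestrictLe (π := fun _ : ℕ => EuclideanSpace ℝ (Fin n) × ℝ) t p.1,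
        θ.next (p.1 t) p.2) := by
  rw [law, ← Kernel.map_frestrictLe_trajMeasure_compProd_eq_map_trajMeasure]
  refine Measure.map_compProd_eq_map_prod _ _ _ (by fun_prop)
    
    (f := fun (past : (i : Finset.Iic t) → EuclideanSpace ℝ (Fin n) × ℝ) w =>
      θ.next (past ⟨t, Finset.mem_Iic.2 le_rfl⟩) w) ?_ ?_
  · exact θ.measurable_next (X := ((i : Finset.Iic t) → EuclideanSpace ℝ (Fin n) × ℝ) ×
        EuclideanSpace ℝ (Fin n) × ℝ)
      (f := fun p => p.1 ⟨t, Finset.mem_Iic.2 le_rfl⟩) (g := fun p => p.2)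
      (by fun_prop) (by fun_prop)
  · intro y
    rw [Kernel.comap_apply, step_eq]

/-- The case `s = t` gives the marginal law at `t + 1`; general `s` gives the lagged covariances. -/
theorem map_pair_succ_law {s t : ℕ} (hst : s ≤ t) :
    θ.law.map (fun ω => (ω s, ω (t + 1))) =
    (θ.law.prod θ.noise).map fun p => (p.1 s, θ.next (p.1 t) p.2) := by
  have hn : Measurable fun p : (ℕ → EuclideanSpace ℝ (Fin n) × ℝ) × EuclideanSpace ℝ (Fin n) × ℝ =>
      θ.next (p.1 t) p.2 := θ.measurable_next (by fun_prop) (by fun_prop)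
  have hq : Measurable fun q : ((i : Finset.Iic t) → EuclideanSpace ℝ (Fin n) × ℝ) ×
      EuclideanSpace ℝ (Fin n) × ℝ => (q.1 ⟨s, Finset.mem_Iic.2 hst⟩, q.2) := by fun_prop
  have hp : Measurable fun p : (ℕ → EuclideanSpace ℝ (Fin n) × ℝ) × EuclideanSpace ℝ (Fin n) × ℝ =>
      (Preorder.frestrictLe (π := fun _ : ℕ => EuclideanSpace ℝ (Fin n) × ℝ) t p.1,
        θ.next (p.1 t) p.2) :=
    ((Preorder.measurable_frestrictLe t).comp measurable_fst).prodMk hn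
  have h := congrArg (Measure.map fun q : ((i : Finset.Iic t) → EuclideanSpace ℝ (Fin n) × ℝ) ×
      EuclideanSpace ℝ (Fin n) × ℝ => (q.1 ⟨s, Finset.mem_Iic.2 hst⟩, q.2))
    (θ.map_past_succ_law t)
  rwa [Measure.map_map hq (by fun_prop), Measure.map_map hq hp] at h

end LinearGaussianGUM

/-! ### Second moments of the model -/

section NoisyObservation

variable {Ω : Type*} [MeasurableSpace Ω] {μ : Measure Ω} {n : ℕ}

theorem MeasureTheory.MemLp.dotProduct {H : Ω → EuclideanSpace ℝ (Fin n)}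
    (hH : ∀ i, MemLp (fun ω => H ω i) 2 μ) (b : Fin n → ℝ) :
    MemLp (fun ω => b ⬝ᵥ H ω) 2 μ :=
  memLp_finsetSum _ fun i _ => (hH i).const_mul (b i)

variable [IsProbabilityMeasure μ]

theorem ProbabilityTheory.covariance_dotProduct_right {H : Ω → EuclideanSpace ℝ (Fin n)}
    (hH : ∀ i, MemLp (fun ω => H ω i) 2 μ) {Y : Ω → ℝ} (hY : MemLp Y 2 μ) (b : Fin n → ℝ) :
    cov[Y, fun ω => b ⬝ᵥ H ω; μ] = ∑ i, b i * cov[Y, fun ω => H ω i; μ] := by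
  simp only [_root_.dotProduct]
  rw [covariance_fun_sum_right (fun i => (hH i).const_mul (b i)) hY]
  simp only [covariance_const_mul_right]

/-- Covariances of an observation `b ⬝ᵥ H + V` whose noise `V` is uncorrelated with `H`. -/
theorem ProbabilityTheory.covariance_noisy_observation {H : Ω → EuclideanSpace ℝ (Fin n)}
    (hH : ∀ i, MemLp (fun ω => H ω i) 2 μ) {V : Ω → ℝ} (hV : MemLp V 2 μ)
    (hHV : ∀ i, cov[fun ω => H ω i, V; μ] = 0) (b : Fin n → ℝ) :
    (∀ i, cov[fun ω => H ω i, fun ω => b ⬝ᵥ H ω + V ω; μ] =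
      ∑ j, b j * cov[fun ω => H ω i, fun ω => H ω j; μ]) ∧
    cov[fun ω => b ⬝ᵥ H ω + V ω, fun ω => b ⬝ᵥ H ω + V ω; μ] =
      ∑ i, b i * cov[fun ω => H ω i, fun ω => b ⬝ᵥ H ω + V ω; μ] + cov[V, V; μ] := by
  have hb := MemLp.dotProduct hH b
  have hbV : MemLp (fun ω => b ⬝ᵥ H ω + V ω) 2 μ := hb.add hV
  have e : (fun ω => b ⬝ᵥ H ω + V ω) = (fun ω => b ⬝ᵥ H ω) + V := rfl
  have h1 : ∀ i, cov[fun ω => H ω i, fun ω => b ⬝ᵥ H ω + V ω; μ] =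
      ∑ j, b j * cov[fun ω => H ω i, fun ω => H ω j; μ] := fun i => by
    rw [e, covariance_add_right (hH i) hb hV, hHV, add_zero, covariance_dotProduct_right hH (hH i)]
  have hVb : cov[V, fun ω => b ⬝ᵥ H ω; μ] = 0 := by
    rw [covariance_dotProduct_right hH hV]
    exact Finset.sum_eq_zero fun i _ => by rw [covariance_comm, hHV, mul_zero]
  refine ⟨h1, ?_⟩
  have h2 : cov[fun ω => b ⬝ᵥ H ω + V ω, fun ω => b ⬝ᵥ H ω; μ] =
      ∑ i, b i * cov[fun ω => H ω i, fun ω => b ⬝ᵥ H ω + V ω; μ] := by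
    rw [covariance_dotProduct_right hH hbV]
    simp only [covariance_comm]
  rw [← h2]
  nth_rw 2 [e]
  rw [covariance_add_right hbV hb hV]
  congr 1
  rw [e, covariance_add_left hb hV hV, covariance_comm, hVb, zero_add]

end NoisyObservation

theorem ProbabilityTheory.covariance_prod_fst_fst {X Y : Type*} [MeasurableSpace X] [MeasurableSpace Y]
    {μ : Measure X} [IsProbabilityMeasure μ] {ν : Measure Y} [IsProbabilityMeasure ν]
    {f g : X → ℝ} (hf : MemLp f 2 μ) (hg : MemLp g 2 μ) :
    cov[fun p => f p.1, fun p => g p.1; μ.prod ν] = cov[f, g; μ] := by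
  have e : μ = (μ.prod ν).map Prod.fst := measurePreserving_fst.map_eq.symm
  conv_rhs => rw [e]
  rw [covariance_map_fun (e ▸ hf.1) (e ▸ hg.1) (by fun_prop)]

theorem ProbabilityTheory.covariance_prod_snd_snd {X Y : Type*} [MeasurableSpace X] [MeasurableSpace Y]
    {μ : Measure X} [IsProbabilityMeasure μ] {ν : Measure Y} [IsProbabilityMeasure ν]
    {f g : Y → ℝ} (hf : MemLp f 2 ν) (hg : MemLp g 2 ν) :
    cov[fun p => f p.2, fun p => g p.2; μ.prod ν] = cov[f, g; ν] := by
  have e : ν = (μ.prod ν).map Prod.snd := measurePreserving_snd.map_eq.symm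
  conv_rhs => rw [e]
  rw [covariance_map_fun (e ▸ hf.1) (e ▸ hg.1) (by fun_prop)]

namespace LinearGaussianGUM

variable {n : ℕ} (θ : LinearGaussianGUM n)

theorem drift_apply (z : EuclideanSpace ℝ (Fin n) × ℝ) (i : Fin n) :
    θ.drift z i = θ.a i ⬝ᵥ z.1 + z.2 * θ.c i := rfl

theorem memLp_noise_fst (i : Fin n) : MemLp (fun w => w.1 i) 2 θ.noise :=
  (memLp_eval_multivariateGaussian 0 θ.α i).comp_fst _

theorem memLp_noise_snd : MemLp (fun w => w.2) 2 θ.noise :=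
  (memLp_id_gaussianReal 2).comp_snd (ν := gaussianReal 0 θ.β) _

theorem covariance_noise_fst (i j : Fin n) :
    cov[fun w => w.1 i, fun w => w.1 j; θ.noise] = θ.α i j := by
  rw [← covariance_eval_multivariateGaussian (μ := 0) θ.posSemidef_α i j]
  exact covariance_prod_fst_fst (memLp_eval_multivariateGaussian 0 θ.α i)
    (memLp_eval_multivariateGaussian 0 θ.α j)

theorem covariance_prod_snd {X : Type*} [MeasurableSpace X] (μ : Measure X)
    [IsProbabilityMeasure μ] (β : ℝ≥0) :
    cov[fun p => p.2, fun p => p.2; μ.prod (gaussianReal 0 β)] = β := by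
  have h : cov[fun x => x, fun x => x; gaussianReal 0 β] = β := by
    rw [covariance_self (by fun_prop)]; exact variance_id_gaussianReal
  rw [← h]
  exact covariance_prod_snd_snd (memLp_id_gaussianReal 2) (memLp_id_gaussianReal 2)

theorem covariance_noise_snd : cov[fun w => w.2, fun w => w.2; θ.noise] = θ.β :=
  covariance_prod_snd _ _

/-- Square integrability of `h_t` and `x_t`. -/
def MemLpTwo (t : ℕ) : Prop :=
  (∀ i, MemLp (fun ω => latent n t ω i) 2 θ.law) ∧ MemLp (observation n t) 2 θ.law

/-- The covariances between `h_t` and `x_t` are those forced by the emission. -/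
def EmissionCovariance (t : ℕ) : Prop :=
  (∀ i, cov[fun ω => latent n t ω i, observation n t; θ.law] =
      ∑ j, θ.b j * cov[fun ω => latent n t ω i, fun ω => latent n t ω j; θ.law]) ∧
    cov[observation n t, observation n t; θ.law] =
      ∑ i, θ.b i * cov[fun ω => latent n t ω i, observation n t; θ.law] + θ.β

/-- Transfer of moments of order two along an equality of the laws of `(h_t, x_t)` and
`(H, b H + V)`. -/
theorem moments_of_map_eq {t : ℕ} {Ω : Type*} [MeasurableSpace Ω] {μ : Measure Ω}
    [IsProbabilityMeasure μ] {H : Ω → EuclideanSpace ℝ (Fin n)} {V : Ω → ℝ}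
    (hH : Measurable H) (hV : Measurable V)
    (h : θ.law.map (fun ω => ω t) = μ.map fun p => (H p, θ.b ⬝ᵥ H p + V p))
    (hH2 : ∀ i, MemLp (fun p => H p i) 2 μ) (hV2 : MemLp V 2 μ)
    (hHV : ∀ i, cov[fun p => H p i, V; μ] = 0) (hVV : cov[V, V; μ] = θ.β) :
    θ.MemLpTwo t ∧ θ.EmissionCovariance t ∧
      ∀ i j, cov[fun ω => latent n t ω i, fun ω => latent n t ω j; θ.law] =
        cov[fun p => H p i, fun p => H p j; μ] := by
  have hm : Measurable fun p => (H p, θ.b ⬝ᵥ H p + V p) :=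
    hH.prodMk ((θ.measurable_dotProduct_b.comp hH).add hV)
  have hmem : ∀ f : EuclideanSpace ℝ (Fin n) × ℝ → ℝ, Measurable f →
      MemLp (fun p => f (H p, θ.b ⬝ᵥ H p + V p)) 2 μ → MemLp (fun ω => f (ω t)) 2 θ.law := by
    intro f hf h2
    have h3 := (memLp_map_measure_iff (p := 2) hf.aestronglyMeasurable hm.aemeasurable).2 h2
    rw [← h] at h3
    exact (memLp_map_measure_iff hf.aestronglyMeasurable (measurable_pi_apply t).aemeasurable).1 h3
  have hcov : ∀ f g : EuclideanSpace ℝ (Fin n) × ℝ → ℝ, Measurable f → Measurable g →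
      cov[fun ω => f (ω t), fun ω => g (ω t); θ.law] =
      cov[fun p => f (H p, θ.b ⬝ᵥ H p + V p), fun p => g (H p, θ.b ⬝ᵥ H p + V p); μ] := by
    intro f g hf hg
    rw [← covariance_map_fun (Z := fun p => (H p, θ.b ⬝ᵥ H p + V p)) hf.aestronglyMeasurable
      hg.aestronglyMeasurable hm.aemeasurable, ← h,
      covariance_map_fun hf.aestronglyMeasurable hg.aestronglyMeasurable
        (measurable_pi_apply t).aemeasurable]
  have hl : ∀ i, Measurable fun z : EuclideanSpace ℝ (Fin n) × ℝ => z.1 i := fun i => by fun_prop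
  have hhh : ∀ i j, cov[fun ω => latent n t ω i, fun ω => latent n t ω j; θ.law] =
        cov[fun p => H p i, fun p => H p j; μ] := fun i j => hcov _ _ (hl i) (hl j)
  have hhx : ∀ i, cov[fun ω => latent n t ω i, observation n t; θ.law] =
      cov[fun p => H p i, fun p => θ.b ⬝ᵥ H p + V p; μ] :=
    fun i => hcov _ _ (hl i) measurable_snd
  have hxx : cov[observation n t, observation n t; θ.law] =
      cov[fun p => θ.b ⬝ᵥ H p + V p, fun p => θ.b ⬝ᵥ H p + V p; μ] :=
    hcov _ _ measurable_snd measurable_snd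
  obtain ⟨h1, h2⟩ := covariance_noisy_observation hH2 hV2 hHV θ.b
  refine ⟨⟨fun i => hmem _ (hl i) (hH2 i),
    hmem _ measurable_snd ((MemLp.dotProduct hH2 θ.b).add hV2)⟩, ⟨?_, ?_⟩, hhh⟩
  · intro i
    simp only [hhx, hhh, h1]
  · rw [hxx, h2, hVV]
    simp only [hhx]

theorem moments_zero : θ.MemLpTwo 0 ∧ θ.EmissionCovariance 0 ∧
    ∀ i j, cov[fun ω => latent n 0 ω i, fun ω => latent n 0 ω j; θ.law] = θ.η i j := by
  obtain ⟨h1, h2, h3⟩ := θ.moments_of_map_eq measurable_fst measurable_snd θ.map_zero_law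
    (fun i => (memLp_eval_multivariateGaussian 0 θ.η i).comp_fst _)
    ((memLp_id_gaussianReal 2).comp_snd _)
    (fun i => covariance_fst_snd_prod (memLp_eval_multivariateGaussian 0 θ.η i)
      (memLp_id_gaussianReal 2)) (covariance_prod_snd _ _)
  refine ⟨h1, h2, fun i j => ?_⟩
  rw [h3, ← covariance_eval_multivariateGaussian (μ := 0) θ.posSemidef_η i j]
  exact covariance_prod_fst_fst (memLp_eval_multivariateGaussian 0 θ.η i)
    (memLp_eval_multivariateGaussian 0 θ.η j)

variable {θ}

theorem MemLpTwo.drift {t : ℕ} (h : θ.MemLpTwo t) (i : Fin n) :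
    MemLp (fun ω => θ.drift (ω t) i) 2 θ.law := by
  simp only [drift_apply]
  exact (MemLp.dotProduct h.1 (θ.a i)).add (h.2.mul_const (θ.c i))

theorem MemLpTwo.next {t : ℕ} (h : θ.MemLpTwo t) (i : Fin n) :
    MemLp (fun p => (θ.next (p.1 t) p.2).1 i) 2 (θ.law.prod θ.noise) :=
  ((h.drift i).comp_fst _).add ((θ.memLp_noise_fst i).comp_snd _)

theorem covariance_drift_right {t : ℕ} (h : θ.MemLpTwo t) {Y : _ → ℝ} (hY : MemLp Y 2 θ.law)
    (i : Fin n) :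
    cov[Y, fun ω => θ.drift (ω t) i; θ.law] =
      ∑ j, θ.a i j * cov[Y, fun ω => latent n t ω j; θ.law] +
        cov[Y, observation n t; θ.law] * θ.c i := by
  have e : (fun ω : ℕ → EuclideanSpace ℝ (Fin n) × ℝ => θ.drift (ω t) i) =
    (fun ω => θ.a i ⬝ᵥ latent n t ω) + fun ω => observation n t ω * θ.c i := rfl
  rw [e, covariance_add_right hY (MemLp.dotProduct h.1 (θ.a i)) (h.2.mul_const (θ.c i)),
    covariance_dotProduct_right h.1 hY, covariance_mul_const_right]

theorem moments_succ {t : ℕ} (h : θ.MemLpTwo t) :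
    θ.MemLpTwo (t + 1) ∧ θ.EmissionCovariance (t + 1) ∧
    ∀ i j, cov[fun ω => latent n (t + 1) ω i, fun ω => latent n (t + 1) ω j; θ.law] =
      cov[fun ω => θ.drift (ω t) i, fun ω => θ.drift (ω t) j; θ.law] + θ.α i j := by
  have hmap : θ.law.map (fun ω => ω (t + 1)) =
      (θ.law.prod θ.noise).map fun p => ((θ.next (p.1 t) p.2).1,
        θ.b ⬝ᵥ (θ.next (p.1 t) p.2).1 + p.2.2) := by
    have h1 := congrArg (Measure.map Prod.snd) (θ.map_pair_succ_law le_rfl (s := t))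
    rwa [Measure.map_map (by fun_prop) (by fun_prop), Measure.map_map (by fun_prop)
      (Measurable.prodMk (by fun_prop) (θ.measurable_next (by fun_prop) (by fun_prop)))] at h1
  have hadd : ∀ i, (fun p : (ℕ → EuclideanSpace ℝ (Fin n) × ℝ) × EuclideanSpace ℝ (Fin n) × ℝ =>
      (θ.next (p.1 t) p.2).1 i) = (fun p => θ.drift (p.1 t) i) + fun p => p.2.1 i :=
    fun i => rfl
  have hd := fun i => (h.drift i).comp_fst θ.noise
  have hw := fun i => (θ.memLp_noise_fst i).comp_snd θ.law
  have hv := θ.memLp_noise_snd.comp_snd θ.law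
  have hHm : Measurable fun p : (ℕ → EuclideanSpace ℝ (Fin n) × ℝ) ×
      EuclideanSpace ℝ (Fin n) × ℝ => (θ.next (p.1 t) p.2).1 :=
    measurable_fst.comp (θ.measurable_next (by fun_prop) (by fun_prop))
  have hHV : ∀ i, cov[fun p => (θ.next (p.1 t) p.2).1 i, fun p => p.2.2;
      θ.law.prod θ.noise] = 0 := fun i => by
    rw [hadd, covariance_add_left (hd i) (hw i) hv,
      covariance_fst_snd_prod (h.drift i) θ.memLp_noise_snd,
      covariance_prod_snd_snd (θ.memLp_noise_fst i) θ.memLp_noise_snd, zero_add]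
    exact covariance_fst_snd_prod (memLp_eval_multivariateGaussian 0 θ.α i)
      (memLp_id_gaussianReal 2)
  have hVV : cov[fun p => p.2.2, fun p => p.2.2; θ.law.prod θ.noise] = θ.β := by
    rw [covariance_prod_snd_snd θ.memLp_noise_snd θ.memLp_noise_snd, covariance_noise_snd]
  obtain ⟨h1, h2, h3⟩ := θ.moments_of_map_eq hHm (measurable_snd.comp measurable_snd) hmap
    h.next hv hHV hVV
  have hwd : ∀ i j, cov[fun p => p.2.1 i, fun p => θ.drift (p.1 t) j; θ.law.prod θ.noise] = 0 :=
    fun i j => by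
      rw [covariance_comm]
      exact covariance_fst_snd_prod (h.drift j) (θ.memLp_noise_fst i)
  refine ⟨h1, h2, fun i j => ?_⟩
  rw [h3, hadd, hadd, covariance_add_left (hd i) (hw i) ((hd j).add (hw j)),
    covariance_add_right (hd i) (hd j) (hw j), covariance_add_right (hw i) (hd j) (hw j),
    covariance_prod_fst_fst (h.drift i) (h.drift j),
    covariance_fst_snd_prod (h.drift i) (θ.memLp_noise_fst j),
    hwd, covariance_prod_snd_snd (θ.memLp_noise_fst i) (θ.memLp_noise_fst j), covariance_noise_fst,
    add_zero, zero_add]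

/-- Both noises entering at time `t + 1` are uncorrelated with `x_s`, so only the deterministic
parts of the recursion contribute. -/
theorem cross_covariance_succ {s t : ℕ} (hst : s ≤ t) (hs : θ.MemLpTwo s) (h : θ.MemLpTwo t) :
    (∀ i, cov[observation n s, fun ω => latent n (t + 1) ω i; θ.law] =
      cov[observation n s, fun ω => θ.drift (ω t) i; θ.law]) ∧
    cov[observation n s, observation n (t + 1); θ.law] =
      ∑ i, θ.b i * cov[observation n s, fun ω => latent n (t + 1) ω i; θ.law] := by
  have hn : Measurable fun p : (ℕ → EuclideanSpace ℝ (Fin n) × ℝ) × EuclideanSpace ℝ (Fin n) × ℝ =>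
      (p.1 s, θ.next (p.1 t) p.2) :=
    Measurable.prodMk (by fun_prop) (θ.measurable_next (by fun_prop) (by fun_prop))
  have hcov : ∀ g : EuclideanSpace ℝ (Fin n) × ℝ → ℝ, Measurable g →
      cov[observation n s, fun ω => g (ω (t + 1)); θ.law] =
      cov[fun p => observation n s p.1, fun p => g (θ.next (p.1 t) p.2);
        θ.law.prod θ.noise] := by
    intro g hg
    have h1 : AEStronglyMeasurable
        (fun q : (EuclideanSpace ℝ (Fin n) × ℝ) × EuclideanSpace ℝ (Fin n) × ℝ => q.1.2)
        (θ.law.map (fun ω => (ω s, ω (t + 1)))) :=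
      Measurable.aestronglyMeasurable (by fun_prop)
    have h2 : AEStronglyMeasurable
        (fun q : (EuclideanSpace ℝ (Fin n) × ℝ) × EuclideanSpace ℝ (Fin n) × ℝ => g q.2)
        (θ.law.map (fun ω => (ω s, ω (t + 1)))) :=
      Measurable.aestronglyMeasurable (by fun_prop)
    have h3 := covariance_map_fun h1 h2 (by fun_prop)
    rw [θ.map_pair_succ_law hst] at h1 h2 h3
    rw [covariance_map_fun h1 h2 hn.aemeasurable] at h3
    exact h3.symm
  have hw := fun i => (θ.memLp_noise_fst i).comp_snd θ.law
  have hv := θ.memLp_noise_snd.comp_snd θ.law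
  have ho := hs.2.comp_fst θ.noise
  have h1 : ∀ i, cov[observation n s, fun ω => latent n (t + 1) ω i; θ.law] =
      cov[fun p => observation n s p.1, fun p => (θ.next (p.1 t) p.2).1 i;
        θ.law.prod θ.noise] := fun i => hcov (fun z => z.1 i) (by fun_prop)
  refine ⟨fun i => ?_, ?_⟩
  · have hadd : (fun p : (ℕ → EuclideanSpace ℝ (Fin n) × ℝ) × EuclideanSpace ℝ (Fin n) × ℝ =>
      (θ.next (p.1 t) p.2).1 i) = (fun p => θ.drift (p.1 t) i) + fun p => p.2.1 i := rfl
    rw [h1, hadd, covariance_add_right ho ((h.drift i).comp_fst _) (hw i),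
      covariance_prod_fst_fst hs.2 (h.drift i),
      covariance_fst_snd_prod hs.2 (θ.memLp_noise_fst i), add_zero]
  · have hadd : (fun p : (ℕ → EuclideanSpace ℝ (Fin n) × ℝ) × EuclideanSpace ℝ (Fin n) × ℝ =>
      (θ.next (p.1 t) p.2).2) =
        (fun p => θ.b ⬝ᵥ (θ.next (p.1 t) p.2).1) + fun p => p.2.2 := rfl
    have h2 : cov[observation n s, observation n (t + 1); θ.law] = _ :=
      hcov (fun z => z.2) (by fun_prop)
    rw [h2, hadd, covariance_add_right ho (MemLp.dotProduct h.next θ.b) hv,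
      covariance_fst_snd_prod hs.2 θ.memLp_noise_snd, add_zero,
      covariance_dotProduct_right h.next ho]
    simp only [h1]

end LinearGaussianGUM

/-! ### Stationarity and realization from the Lyapunov equation -/

namespace LinearGaussianGUM

variable {n : ℕ} {θ : LinearGaussianGUM n}

/-- Substituting `x = b h + v` in `a h + c x` gives `(a + c b) h + c v` with `v` uncorrelated with
`h`; the covariance is `F η Fᵀ + β c cᵀ` for `F = a + c b`. -/
theorem covariance_drift_drift {t : ℕ} (h : θ.MemLpTwo t) (he : θ.EmissionCovariance t)
    (hη : ∀ i j, cov[fun ω => latent n t ω i, fun ω => latent n t ω j; θ.law] = θ.η i j)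
    (i j : Fin n) :
    cov[fun ω => θ.drift (ω t) i, fun ω => θ.drift (ω t) j; θ.law] =
      ∑ k, ∑ l, (θ.a j k + θ.c j * θ.b k) * (θ.a i l + θ.c i * θ.b l) * θ.η k l +
        θ.β * θ.c i * θ.c j := by
  have hs : ∀ k l, θ.η k l = θ.η l k := fun k l => by rw [← hη, ← hη, covariance_comm]
  obtain ⟨hx, hxx⟩ := he
  simp only [hη] at hx
  have hA : ∀ k, cov[fun ω => latent n t ω k, fun ω => θ.drift (ω t) i; θ.law] =
      ∑ l, (θ.a i l + θ.c i * θ.b l) * θ.η k l := fun k => by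
    rw [covariance_drift_right h (h.1 k), hx, Finset.sum_mul, ← Finset.sum_add_distrib]
    exact Finset.sum_congr rfl fun l _ => by rw [hη]; ring
  have hB : cov[observation n t, fun ω => θ.drift (ω t) i; θ.law] =
      ∑ l, (θ.a i l + θ.c i * θ.b l) * ∑ k, θ.b k * θ.η k l + θ.β * θ.c i := by
    rw [covariance_drift_right h h.2, hxx, add_mul, Finset.sum_mul, ← add_assoc,
      ← Finset.sum_add_distrib]
    congr 1
    refine Finset.sum_congr rfl fun l _ => ?_
    rw [covariance_comm, hx]
    simp only [hs l]
    ring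
  rw [covariance_drift_right h (h.drift i), covariance_comm _ (observation n t), hB]
  have hA' : ∀ k, cov[fun ω => θ.drift (ω t) i, fun ω => latent n t ω k; θ.law] =
      ∑ l, (θ.a i l + θ.c i * θ.b l) * θ.η k l := fun k => by rw [covariance_comm, hA]
  simp only [hA']
  have e : ∑ l, (θ.a i l + θ.c i * θ.b l) * ∑ k, θ.b k * θ.η k l =
      ∑ k, θ.b k * ∑ l, (θ.a i l + θ.c i * θ.b l) * θ.η k l := by
    simp only [Finset.mul_sum]
    rw [Finset.sum_comm]
    exact Finset.sum_congr rfl fun k _ => Finset.sum_congr rfl fun l _ => by ring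
  rw [e, add_mul, ← add_assoc, Finset.sum_mul, ← Finset.sum_add_distrib]
  congr 1
  · refine Finset.sum_congr rfl fun k _ => ?_
    simp only [Finset.mul_sum, Finset.sum_mul]
    rw [← Finset.sum_add_distrib]
    exact Finset.sum_congr rfl fun l _ => by ring

theorem moments_of_stationary
    (hη : ∀ i j, θ.η i j = ∑ k, ∑ l, (θ.a j k + θ.c j * θ.b k) * (θ.a i l + θ.c i * θ.b l) *
      θ.η k l + θ.β * θ.c i * θ.c j + θ.α i j) (t : ℕ) :
    θ.MemLpTwo t ∧ θ.EmissionCovariance t ∧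
      ∀ i j, cov[fun ω => latent n t ω i, fun ω => latent n t ω j; θ.law] = θ.η i j := by
  induction t with
  | zero => exact θ.moments_zero
  | succ t ih =>
    obtain ⟨h1, h2, h3⟩ := ih
    obtain ⟨g1, g2, g3⟩ := moments_succ h1
    refine ⟨g1, g2, fun i j => ?_⟩
    rw [g3, covariance_drift_drift h1 h2 h3, ← hη]

/-- A model is stationary and realizes `r` as soon as its parameters satisfy the Lyapunov equation
and the covariances forced by it are the first ones of `r`, the vectors `(r (k + i + 1))` being
propagated by `a + c b`. -/
theorem isStationary_and_realizes {r : ℕ → ℝ}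
    (hη : ∀ i j, θ.η i j = ∑ k, ∑ l, (θ.a j k + θ.c j * θ.b k) * (θ.a i l + θ.c i * θ.b l) *
      θ.η k l + θ.β * θ.c i * θ.c j + θ.α i j)
    (h0 : r 0 = ∑ i, ∑ j, θ.b i * θ.b j * θ.η i j + θ.β)
    (h1 : ∀ i : Fin n, r (i + 1) =
      ∑ k, ∑ l, (θ.a i k + θ.c i * θ.b k) * θ.b l * θ.η k l + θ.β * θ.c i)
    (hF : ∀ (k : ℕ) (i : Fin n),
      r (k + i + 2) = ∑ j : Fin n, (θ.a i j + θ.c i * θ.b j) * r (k + j + 1))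
    (hb : ∀ k : ℕ, r (k + 1) = ∑ j : Fin n, θ.b j * r (k + j + 1)) :
    θ.IsStationary ∧ θ.Realizes r := by
  have hm := moments_of_stationary hη
  refine ⟨fun t => (hm t).2.2, fun t => (hm t).1.2, fun t k => ?_⟩
  have hxh : ∀ i, cov[observation n t, fun ω => latent n t ω i; θ.law] =
      ∑ j, θ.b j * θ.η i j := fun i => by
    rw [covariance_comm, (hm t).2.1.1]
    simp only [(hm t).2.2]
  have hxx : cov[observation n t, observation n t; θ.law] = r 0 := by
    rw [(hm t).2.1.2, h0]
    congr 1
    refine Finset.sum_congr rfl fun i _ => ?_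
    rw [covariance_comm, hxh, Finset.mul_sum]
    exact Finset.sum_congr rfl fun j _ => by ring
  -- The vector `Cov(x_t, h_{t+k+1})` is propagated by `a + c b`. Only the first step differs: there
  -- `Var(x_t)` contributes the extra term `β c`.
  have key : ∀ k, (∀ i : Fin n, cov[observation n t, fun ω => latent n (t + k + 1) ω i; θ.law] =
      r (k + i + 1)) ∧ cov[observation n t, observation n (t + k + 1); θ.law] = r (k + 1) := by
    intro k
    have hh : ∀ i : Fin n,
        cov[observation n t, fun ω => latent n (t + k + 1) ω i; θ.law] = r (k + i + 1) := by
      induction k with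
      | zero =>
        intro i
        rw [(cross_covariance_succ (Nat.le_add_right t 0) (hm t).1 (hm _).1).1,
          covariance_drift_right (hm _).1 (hm t).1.2, add_zero, hxx, zero_add, h1, h0, add_mul,
          ← add_assoc, Finset.sum_mul, ← Finset.sum_add_distrib]
        congr 1
        refine Finset.sum_congr rfl fun k _ => ?_
        rw [hxh, Finset.mul_sum, Finset.sum_mul, ← Finset.sum_add_distrib]
        exact Finset.sum_congr rfl fun l _ => by ring
      | succ k ih =>
        intro i
        rw [(cross_covariance_succ (by lia) (hm t).1 (hm _).1).1,
          covariance_drift_right (hm _).1 (hm t).1.2, ← add_assoc,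
          (cross_covariance_succ (by lia) (hm t).1 (hm _).1).2,
          show k + 1 + (i : ℕ) + 1 = k + i + 2 by ring, hF, Finset.sum_mul,
          ← Finset.sum_add_distrib]
        exact Finset.sum_congr rfl fun j _ => by rw [ih]; ring
    refine ⟨hh, ?_⟩
    rw [(cross_covariance_succ (by lia) (hm t).1 (hm _).1).2, hb]
    exact Finset.sum_congr rfl fun j _ => by rw [hh]
  cases k with
  | zero => exact hxx
  | succ k => exact (key k).2

end LinearGaussianGUM

/-! ### Finite-horizon prediction in a Euclidean space -/

open scoped MatrixOrder in
theorem IsCovarianceSeries.exists_inner_eq {r : ℕ → ℝ} (hr : IsCovarianceSeries r) (m : ℕ) :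
    ∃ x : ℕ → EuclideanSpace ℝ (Fin (m + 1)), ∀ i ≤ m, ∀ j ≤ m,
      inner ℝ (x i) (x j) = r ((j : ℤ) - (i : ℤ)).natAbs := by
  let T : Matrix (Fin (m + 1)) (Fin (m + 1)) ℝ :=
    Matrix.of fun i j => r ((j : ℤ) - (i : ℤ)).natAbs
  have hT : T.PosSemidef := by
    refine Matrix.PosSemidef.of_dotProduct_mulVec_nonneg ?_ fun u => ?_
    · ext i j
      simp only [T, Matrix.conjTranspose_apply, Matrix.of_apply, star_trivial]
      rw [← Int.natAbs_neg, neg_sub]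
    · have h := hr m fun i => if hi : i < m + 1 then u ⟨i, hi⟩ else 0
      rw [Finset.sum_range] at h
      simp only [Finset.sum_range, Fin.is_lt, dite_true, Fin.eta] at h
      refine h.trans_eq ?_
      simp only [dotProduct, Matrix.mulVec, star_trivial, Finset.mul_sum, T, Matrix.of_apply]
      exact Finset.sum_congr rfl fun i _ => Finset.sum_congr rfl fun j _ => by ring
  obtain ⟨B, hB⟩ : ∃ B, T = Bᴴ * B := by
    refine ⟨CFC.sqrt T, ?_⟩
    have h : (CFC.sqrt T)ᴴ = CFC.sqrt T := (CFC.sqrt_nonneg T).isSelfAdjoint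
    rw [h, CFC.sqrt_mul_sqrt_self _ hT.nonneg]
  -- The vectors are the columns of a square root of the Toeplitz matrix; the value beyond `m` is
  -- irrelevant.
  refine ⟨fun k => if hk : k < m + 1 then WithLp.toLp 2 fun l => B l ⟨k, hk⟩ else 0,
    fun i hi j hj => ?_⟩
  have h := congrFun (congrFun hB ⟨i, by lia⟩) ⟨j, by lia⟩
  simp only [T, Matrix.of_apply] at h
  simp only [Nat.lt_succ_of_le hi, Nat.lt_succ_of_le hj, dite_true, h]
  simp [PiLp.inner_apply, Matrix.mul_apply, mul_comm]

section Prediction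

variable {E : Type*} [NormedAddCommGroup E] [InnerProductSpace ℝ E]

/-- The span of the observations before time `t`. -/
def pastSpan (x : ℕ → E) (t : ℕ) : Submodule ℝ E := Submodule.span ℝ (x '' Set.Iio t)

theorem mem_pastSpan (x : ℕ → E) {s t : ℕ} (h : s < t) : x s ∈ pastSpan x t :=
  Submodule.subset_span ⟨s, h, rfl⟩

theorem norm_sum_smul_sq {ι : Type*} [Fintype ι] (u : ι → ℝ) (y : ι → E) :
    ‖∑ i, u i • y i‖ ^ 2 = ∑ i, ∑ j, u i * u j * inner ℝ (y i) (y j) := by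
  rw [← real_inner_self_eq_norm_sq, sum_inner]
  refine Finset.sum_congr rfl fun i _ => ?_
  rw [inner_sum]
  refine Finset.sum_congr rfl fun j _ => ?_
  rw [real_inner_smul_left, real_inner_smul_right]
  ring

variable [FiniteDimensional ℝ E]

/-- The prediction of the observation at time `t + i` from those before time `t`. -/
noncomputable def prediction (x : ℕ → E) (t i : ℕ) : E := (pastSpan x t).starProjection (x (t + i))

/-- This turns linear relations between covariances, which are all that `r` provides, into relations
between predictions. -/
theorem starProjection_pastSpan_congr {x : ℕ → E} {t : ℕ} {y z : E}
    (h : ∀ s < t, inner ℝ (x s) y = inner ℝ (x s) z) :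
    (pastSpan x t).starProjection y = (pastSpan x t).starProjection z := by
  rw [← sub_eq_zero, ← map_sub, Submodule.starProjection_apply_eq_zero_iff,
    pastSpan, Submodule.mem_orthogonal]
  intro u hu
  induction hu using Submodule.span_induction with
  | mem u hu =>
    obtain ⟨s, hs, rfl⟩ := hu
    rw [inner_sub_right, h s hs, sub_self]
  | zero => simp
  | add u v _ _ hu hv => rw [inner_add_left, hu, hv, add_zero]
  | smul c u _ hu => rw [inner_smul_left, hu, mul_zero]

/-- Tower property of projections onto nested subspaces. -/
theorem starProjection_prediction_succ (x : ℕ → E) (t i : ℕ) :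
    (pastSpan x t).starProjection (prediction x (t + 1) i) = prediction x t (i + 1) := by
  have hle : pastSpan x t ≤ pastSpan x (t + 1) :=
    Submodule.span_mono (Set.image_mono (Set.Iio_subset_Iio (Nat.le_succ t)))
  rw [prediction, prediction, show t + (i + 1) = t + 1 + i by ring]
  refine starProjection_pastSpan_congr fun s hs => ?_
  rw [← Submodule.inner_starProjection_left_eq_right,
    Submodule.starProjection_eq_self_iff.2 (hle (mem_pastSpan x hs))]

theorem norm_prediction_le (x : ℕ → E) (t i : ℕ) : ‖prediction x t i‖ ≤ ‖x (t + i)‖ :=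
  Submodule.norm_starProjection_apply_le _ _

/-- The Riccati-type inequality between the Gram matrices of two successive predictions. -/
theorem gram_prediction_le {r : ℕ → ℝ} {n m : ℕ} {F : Matrix (Fin n) (Fin n) ℝ} {b : Fin n → ℝ}
    (hF : ∀ (k : ℕ) (i : Fin n), r (k + i + 2) = ∑ j : Fin n, F i j * r (k + j + 1))
    (hb : ∀ k : ℕ, r (k + 1) = ∑ j : Fin n, b j * r (k + j + 1)) {x : ℕ → E}
    (hx : ∀ i ≤ m, ∀ j ≤ m, inner ℝ (x i) (x j) = r ((j : ℤ) - (i : ℤ)).natAbs)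
    {t : ℕ} (ht : t + n ≤ m) (u : Fin n → ℝ) (s : ℝ) :
    ∑ j, ∑ k, (∑ i, u i * F i j + s * b j) * (∑ i, u i * F i k + s * b k) *
        inner ℝ (prediction x t j) (prediction x t k) ≤
      ∑ i, ∑ j, u i * u j * inner ℝ (prediction x (t + 1) i) (prediction x (t + 1) j) +
        2 * s * ∑ i, u i * r (i + 1) + s ^ 2 * r 0 := by
  have hpos : ∀ i j, i ≤ m → j ≤ m → i ≤ j → inner ℝ (x i) (x j) = r (j - i) :=
    fun i j hi hj hij => by rw [hx i hi j hj]; congr 1; lia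
  -- Against a past vector `x s` with `s < t` only lags at least one occur, so the recurrence
  -- applies with `k = t - 1 - s`.
  have hpF : ∀ i : Fin n, prediction x t (i + 1) = ∑ j, F i j • prediction x t j := fun i => by
    simp only [prediction, ← map_smul, ← map_sum]
    refine starProjection_pastSpan_congr fun s hs => ?_
    rw [inner_sum, hpos _ _ (by lia) (by lia) (by lia),
      show t + (i + 1 : ℕ) - s = (t - 1 - s) + i + 2 by lia, hF]
    refine Finset.sum_congr rfl fun j _ => ?_
    rw [real_inner_smul_right, hpos _ _ (by lia) (by lia) (by lia)]
    congr 2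
    lia
  have hpb : (pastSpan x t).starProjection (x t) = ∑ j, b j • prediction x t j := by
    simp only [prediction, ← map_smul, ← map_sum]
    refine starProjection_pastSpan_congr fun s hs => ?_
    rw [inner_sum, hpos _ _ (by lia) (by lia) (by lia), show t - s = (t - 1 - s) + 1 by lia, hb]
    refine Finset.sum_congr rfl fun j _ => ?_
    rw [real_inner_smul_right, hpos _ _ (by lia) (by lia) (by lia)]
    congr 2
    lia
  have hN : ∀ i : Fin n, inner ℝ (prediction x (t + 1) i) (x t) = r (i + 1) := fun i => by
    rw [prediction, Submodule.inner_starProjection_left_eq_right,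
      Submodule.starProjection_eq_self_iff.2 (mem_pastSpan x (Nat.lt_succ_self t)),
      real_inner_comm, hpos _ _ (by lia) (by lia) (by lia)]
    congr 1
    lia
  have h0 : inner ℝ (x t) (x t) = r 0 := by
    rw [hpos _ _ (by lia) (by lia) le_rfl, Nat.sub_self]
  -- The claim is that projecting this vector onto the past of `t` does not increase its norm.
  have hy : (pastSpan x t).starProjection (∑ i, u i • prediction x (t + 1) i + s • x t) =
      ∑ j, (∑ i, u i * F i j + s * b j) • prediction x t j := by
    simp only [map_add, map_sum, map_smul, starProjection_prediction_succ, hpF, hpb,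
      Finset.smul_sum, smul_smul, add_smul, Finset.sum_add_distrib, Finset.sum_smul]
    rw [Finset.sum_comm]
  rw [← norm_sum_smul_sq, ← hy]
  refine (pow_le_pow_left₀ (norm_nonneg _)
    (Submodule.norm_starProjection_apply_le _ _) 2).trans_eq ?_
  rw [norm_add_sq_real, norm_sum_smul_sq, norm_smul, mul_pow, Real.norm_eq_abs, sq_abs,
    ← real_inner_self_eq_norm_sq, h0, real_inner_smul_right, sum_inner]
  simp only [real_inner_smul_left, hN]
  ring

end Prediction

/-! ### The state covariance by averaging and compactness -/

theorem abs_mean_le {T : ℕ} (hT : 0 < T) {f : ℕ → ℝ} {C : ℝ} (h : ∀ t < T, |f t| ≤ C) :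
    |(T : ℝ)⁻¹ * ∑ t ∈ Finset.range T, f t| ≤ C := by
  have hT' : (0 : ℝ) < T := by exact_mod_cast hT
  rw [abs_mul, abs_of_pos (inv_pos.2 hT'), inv_mul_le_iff₀ hT']
  refine (Finset.abs_sum_le_sum_abs _ _).trans ?_
  refine (Finset.sum_le_sum fun t ht => h t (Finset.mem_range.1 ht)).trans_eq ?_
  simp

/-- Averages of the Gram matrices of predictions nearly satisfy the inequality characterizing the
state covariances of stationary realizations. -/
theorem IsCovarianceSeries.exists_approx {r : ℕ → ℝ} (hr : IsCovarianceSeries r) {n : ℕ}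
    {F : Matrix (Fin n) (Fin n) ℝ} {b : Fin n → ℝ}
    (hF : ∀ (k : ℕ) (i : Fin n), r (k + i + 2) = ∑ j : Fin n, F i j * r (k + j + 1))
    (hb : ∀ k : ℕ, r (k + 1) = ∑ j : Fin n, b j * r (k + j + 1)) {T : ℕ} (hT : 0 < T) :
    ∃ P : Fin n → Fin n → ℝ, (∀ i j, P i j = P j i) ∧ (∀ i j, |P i j| ≤ r 0) ∧
      (∀ u : Fin n → ℝ, 0 ≤ ∑ i, ∑ j, u i * u j * P i j) ∧
      ∀ (u : Fin n → ℝ) (s : ℝ),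
        ∑ j, ∑ k, (∑ i, u i * F i j + s * b j) * (∑ i, u i * F i k + s * b k) * P j k ≤
        ∑ i, ∑ j, u i * u j * P i j + 2 * s * ∑ i, u i * r (i + 1) + s ^ 2 * r 0 +
          (T : ℝ)⁻¹ * ∑ i, ∑ j, |u i * u j| * (2 * r 0) := by
  have hT' : (0 : ℝ) < T := by exact_mod_cast hT
  obtain ⟨x, hx⟩ := hr.exists_inner_eq (T + n)
  let G : ℕ → Fin n → Fin n → ℝ := fun t i j => inner ℝ (prediction x t i) (prediction x t j)
  have hxn : ∀ i ≤ T + n, ‖x i‖ ^ 2 = r 0 := fun i hi => by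
    rw [← real_inner_self_eq_norm_sq, hx i hi i hi]; simp
  have hG : ∀ t ≤ T, ∀ i j, |G t i j| ≤ r 0 := fun t ht i j => by
    refine (abs_real_inner_le_norm _ _).trans ?_
    have h1 := norm_prediction_le x t i
    have h2 := norm_prediction_le x t j
    have h3 := hxn (t + i) (by lia)
    have h4 := hxn (t + j) (by lia)
    nlinarith [norm_nonneg (prediction x t i), norm_nonneg (prediction x t j),
      sq_nonneg (‖prediction x t i‖ - ‖prediction x t j‖)]
  have hsum : ∀ (w : Fin n → ℝ) (f : ℕ → Fin n → Fin n → ℝ),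
      ∑ i, ∑ j, w i * w j * ((T : ℝ)⁻¹ * ∑ t ∈ Finset.range T, f t i j) =
      (T : ℝ)⁻¹ * ∑ t ∈ Finset.range T, ∑ i, ∑ j, w i * w j * f t i j := by
    intro w f
    simp only [Finset.mul_sum]
    rw [Finset.sum_comm (s := Finset.range T)]
    refine Finset.sum_congr rfl fun i _ => ?_
    rw [Finset.sum_comm (s := Finset.range T)]
    refine Finset.sum_congr rfl fun j _ => ?_
    exact Finset.sum_congr rfl fun t _ => by ring
  refine ⟨fun i j => (T : ℝ)⁻¹ * ∑ t ∈ Finset.range T, G t i j, fun i j => ?_, fun i j => ?_,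
    fun u => ?_, fun u s => ?_⟩
  · simp only [G, real_inner_comm]
  · exact abs_mean_le hT fun t ht => hG t ht.le i j
  · rw [hsum]
    refine mul_nonneg (by positivity) (Finset.sum_nonneg fun t _ => ?_)
    rw [← norm_sum_smul_sq]
    positivity
  · rw [hsum, hsum]
    have h1 := Finset.sum_le_sum fun t (ht : t ∈ Finset.range T) =>
      gram_prediction_le hF hb hx (t := t) (by have := Finset.mem_range.1 ht; lia) u s
    have h2 := mul_le_mul_of_nonneg_left h1 (inv_nonneg.2 hT'.le)
    refine h2.trans ?_
    simp only [Finset.sum_add_distrib, Finset.sum_const, Finset.card_range, nsmul_eq_mul]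
    -- The sums at times `t + 1` and `t` differ by the telescoped term `G T - G 0`, whose entries
    -- are at most `2 * r 0`.
    have h3 : ∑ t ∈ Finset.range T, ∑ i, ∑ j, u i * u j * G (t + 1) i j =
        ∑ t ∈ Finset.range T, ∑ i, ∑ j, u i * u j * G t i j +
        ∑ i, ∑ j, u i * u j * (G T i j - G 0 i j) := by
      have := Finset.sum_range_sub (fun t => ∑ i, ∑ j, u i * u j * G t i j) T
      simp only [mul_sub, Finset.sum_sub_distrib] at this ⊢
      linarith
    have h4 : ∑ i, ∑ j, u i * u j * (G T i j - G 0 i j) ≤ ∑ i, ∑ j, |u i * u j| * (2 * r 0) := by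
      refine Finset.sum_le_sum fun i _ => Finset.sum_le_sum fun j _ => ?_
      refine (le_abs_self _).trans ?_
      rw [abs_mul]
      refine mul_le_mul_of_nonneg_left ?_ (abs_nonneg _)
      have h5 := abs_le.1 (hG T le_rfl i j)
      have h6 := abs_le.1 (hG 0 (Nat.zero_le _) i j)
      exact abs_le.2 ⟨by linarith, by linarith⟩
    change (T : ℝ)⁻¹ * (∑ t ∈ Finset.range T, ∑ i, ∑ j, u i * u j * G (t + 1) i j + _ + _) ≤ _
    rw [h3]
    have h7 := mul_le_mul_of_nonneg_left h4 (inv_nonneg.2 hT'.le)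
    simp only [mul_add, inv_mul_cancel_left₀ hT'.ne']
    linarith

/-- The approximate solutions lie in a fixed compact box; along a convergent subsequence the error
vanishes and the closed conditions pass to the limit. -/
theorem IsCovarianceSeries.exists_stateCovariance {r : ℕ → ℝ} (hr : IsCovarianceSeries r) {n : ℕ}
    {F : Matrix (Fin n) (Fin n) ℝ} {b : Fin n → ℝ}
    (hF : ∀ (k : ℕ) (i : Fin n), r (k + i + 2) = ∑ j : Fin n, F i j * r (k + j + 1))
    (hb : ∀ k : ℕ, r (k + 1) = ∑ j : Fin n, b j * r (k + j + 1)) :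
    ∃ P : Fin n → Fin n → ℝ, (∀ i j, P i j = P j i) ∧
      (∀ u : Fin n → ℝ, 0 ≤ ∑ i, ∑ j, u i * u j * P i j) ∧
      ∀ (u : Fin n → ℝ) (s : ℝ),
        ∑ j, ∑ k, (∑ i, u i * F i j + s * b j) * (∑ i, u i * F i k + s * b k) * P j k ≤
        ∑ i, ∑ j, u i * u j * P i j + 2 * s * ∑ i, u i * r (i + 1) + s ^ 2 * r 0 := by
  choose P hsymm hbdd hpos hform using fun T : ℕ => hr.exists_approx hF hb (Nat.succ_pos T)
  have hc : IsCompact (Set.univ.pi fun _ : Fin n => Set.univ.pi fun _ : Fin n =>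
      Set.Icc (-r 0) (r 0)) :=
    isCompact_univ_pi fun _ => isCompact_univ_pi fun _ => isCompact_Icc
  obtain ⟨Q, -, φ, hφ, hQ⟩ := hc.tendsto_subseq (x := P) fun T i _ j _ => abs_le.1 (hbdd T i j)
  have hQij : ∀ i j, Tendsto (fun T => P (φ T) i j) atTop (𝓝 (Q i j)) := fun i j =>
    tendsto_pi_nhds.1 (tendsto_pi_nhds.1 hQ i) j
  have hq : ∀ w : Fin n → ℝ, Tendsto (fun T => ∑ i, ∑ j, w i * w j * P (φ T) i j) atTop
      (𝓝 (∑ i, ∑ j, w i * w j * Q i j)) := fun w =>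
    tendsto_finsetSum _ fun i _ => tendsto_finsetSum _ fun j _ => (hQij i j).const_mul _
  refine ⟨Q, fun i j => ?_, fun u => ?_, fun u s => ?_⟩
  · exact tendsto_nhds_unique (hQij i j) (by simpa only [hsymm _ i j] using hQij j i)
  · exact ge_of_tendsto' (hq u) fun T => hpos _ u
  · have he : Tendsto (fun T => ((φ T + 1 : ℕ) : ℝ)⁻¹ * ∑ i, ∑ j, |u i * u j| * (2 * r 0)) atTop
        (𝓝 0) := by
      have h1 : Tendsto (fun T : ℕ => ((T + 1 : ℕ) : ℝ)⁻¹) atTop (𝓝 0) := by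
        simpa using tendsto_one_div_add_atTop_nhds_zero_nat (𝕜 := ℝ)
      simpa using (h1.comp hφ.tendsto_atTop).mul_const (∑ i, ∑ j, |u i * u j| * (2 * r 0))
    have h2 := ((((hq u).add_const (2 * s * ∑ i, u i * r (i + 1))).add_const
      (s ^ 2 * r 0))).add he
    rw [add_zero] at h2
    exact le_of_tendsto_of_tendsto' (hq _) h2 fun T => hform _ u s

/-! ### Recurrences, companion matrices and stability -/

/-- `f 0, …, f d` are the coefficients of a linear recurrence satisfied by `r 1, r 2, …`. -/
def IsRecurrence (r : ℕ → ℝ) (d : ℕ) (f : ℕ → ℝ) : Prop :=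
  f d = 1 ∧ ∀ k, ∑ i ∈ Finset.range (d + 1), f i * r (k + i + 1) = 0

theorem exists_isRecurrence_of_eRank_le {r : ℕ → ℝ} {n : ℕ}
    (hn : (hankelMatrix r).eRank ≤ (n : ℕ∞)) : ∃ d ≤ n, ∃ f, IsRecurrence r d f := by
  classical
  let V := Submodule.span ℝ (Set.range (hankelMatrix r).col)
  let v : Fin (n + 1) → V := fun j => ⟨(hankelMatrix r).col j, Submodule.subset_span ⟨j, rfl⟩⟩
  have hv : ¬ LinearIndependent ℝ v := fun h => by
    have h1 := h.cardinal_le_rank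
    rw [Cardinal.mk_fin] at h1
    have h2 : Cardinal.toENat ((n + 1 : ℕ) : Cardinal) ≤ n :=
      (OrderHomClass.mono Cardinal.toENat h1).trans hn
    have h3 : ((n + 1 : ℕ) : ℕ∞) ≤ n := by rwa [Cardinal.toENat_nat] at h2
    exact absurd (Nat.cast_le.1 h3) (by lia)
  obtain ⟨g, hg, i0, hi0⟩ := Fintype.not_linearIndependent_iff.1 hv
  have hg' : ∀ k, ∑ i : Fin (n + 1), g i * r (k + i + 1) = 0 := fun k => by
    have h := congrFun (congrArg Subtype.val hg) k
    simpa [v, hankelMatrix, Matrix.col] using h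
  -- The order is the last index with nonzero coefficient, by which the relation is then normalized.
  obtain ⟨d, hd, hmax⟩ := (Finset.univ.filter fun i => g i ≠ 0).exists_max_image id
    ⟨i0, by simpa using hi0⟩
  simp only [Finset.mem_filter, Finset.mem_univ, true_and, id] at hd hmax
  let G : ℕ → ℝ := fun i => if h : i < n + 1 then g ⟨i, h⟩ else 0
  have hG : ∀ i : Fin (n + 1), G i = g i := fun i => by simp only [G, i.is_lt, dite_true, Fin.eta]
  refine ⟨d, by lia, fun i => (g d)⁻¹ * G i, ?_, fun k => ?_⟩
  · simp only [hG, inv_mul_cancel₀ hd]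
  have h1 : ∑ i ∈ Finset.range (n + 1), G i * r (k + i + 1) = 0 := by
    rw [Finset.sum_range, ← hg' k]
    simp only [hG]
  have h2 : ∑ i ∈ Finset.range (d + 1), G i * r (k + i + 1) = 0 := by
    rw [← h1]
    refine Finset.sum_subset (Finset.range_mono (by lia)) fun i hi hid => ?_
    rw [Finset.mem_range] at hi hid
    have h3 : g ⟨i, hi⟩ = 0 := by
      by_contra h4
      have h5 : (i : ℕ) ≤ d := hmax _ h4
      lia
    simp [G, h3]
  simp only [mul_assoc, ← Finset.mul_sum, h2, mul_zero]

theorem exists_monic_coeff_eq {R : Type*} [Semiring R] [Nontrivial R] {d : ℕ} {f : ℕ → R}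
    (hf : f d = 1) :
    ∃ p : Polynomial R, p.Monic ∧ p.natDegree = d ∧ ∀ i ≤ d, p.coeff i = f i := by
  let p : Polynomial R := ∑ i ∈ Finset.range (d + 1), Polynomial.monomial i (f i)
  have hc : ∀ i ≤ d, p.coeff i = f i := fun i hi => by
    simp [p, Polynomial.finsetSum_coeff, Polynomial.coeff_monomial, Nat.lt_succ_of_le hi]
  have hd : p.natDegree ≤ d := Polynomial.natDegree_sum_le_of_forall_le _ _ fun i hi =>
    (Polynomial.natDegree_monomial_le _).trans (Nat.lt_succ_iff.1 (Finset.mem_range.1 hi))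
  have h1 : p.coeff d = 1 := by rw [hc d le_rfl, hf]
  refine ⟨p, Polynomial.monic_of_natDegree_le_of_coeff_eq_one d hd h1, hd.antisymm ?_, hc⟩
  exact Polynomial.le_natDegree_of_ne_zero (by rw [h1]; exact one_ne_zero)

/-- The left shift of sequences. -/
def leftShift (R : Type*) [CommSemiring R] : Module.End R (ℕ → R) :=
  LinearMap.funLeft R R Nat.succ

theorem leftShift_pow_apply {R : Type*} [CommSemiring R] (i : ℕ) (s : ℕ → R) (k : ℕ) :
    (leftShift R ^ i) s k = s (k + i) := by
  induction i generalizing k with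
  | zero => rfl
  | succ i ih =>
    rw [pow_succ', Module.End.mul_apply]
    change (leftShift R ^ i) s (k + 1) = _
    rw [ih]; congr 1; ring

theorem aeval_leftShift_apply {R : Type*} [CommSemiring R] (p : Polynomial R) (s : ℕ → R) (k : ℕ) :
    Polynomial.aeval (leftShift R) p s k =
      ∑ i ∈ Finset.range (p.natDegree + 1), p.coeff i * s (k + i) := by
  rw [Polynomial.aeval_eq_sum_range]
  simp [leftShift_pow_apply]

/-- If `r` tends to zero, then the roots of the characteristic polynomial of a recurrence of least
order lie in the open unit disc. -/
theorem norm_root_lt_one_of_isRecurrence {r : ℕ → ℝ} (hr : Tendsto r atTop (𝓝 0)) {d : ℕ}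
    {f : ℕ → ℝ} (hf : IsRecurrence r d f) (hmin : ∀ e < d, ∀ g, ¬ IsRecurrence r e g) {z : ℂ}
    (hz : ∑ i ∈ Finset.range (d + 1), (f i : ℂ) * z ^ i = 0) : ‖z‖ < 1 := by
  by_contra! hz1
  obtain ⟨p, hp, hpd, hpf⟩ := exists_monic_coeff_eq (R := ℂ) (d := d) (f := fun i => (f i : ℂ))
    (by simp [hf.1])
  have hpf' : ∀ i ∈ Finset.range (d + 1), p.coeff i = f i := fun i hi =>
    hpf i (Nat.lt_succ_iff.1 (Finset.mem_range.1 hi))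
  have hroot : p.IsRoot z := by
    rw [Polynomial.IsRoot, Polynomial.eval_eq_sum_range, hpd, ← hz]
    exact Finset.sum_congr rfl fun i hi => by rw [hpf' i hi]
  obtain ⟨q, rfl⟩ := Polynomial.dvd_iff_isRoot.2 hroot
  have hq : q.Monic := (Polynomial.monic_X_sub_C z).of_mul_monic_left hp
  have hqd : q.natDegree + 1 = d := by
    rw [← hpd, (Polynomial.monic_X_sub_C z).natDegree_mul hq, Polynomial.natDegree_X_sub_C, add_comm]
  let ρ : ℕ → ℂ := fun k => (r (k + 1) : ℂ)
  -- With the factor `X - z` removed, what remains is geometric of ratio `z`. It tends to zero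
  -- although `‖z‖ ≥ 1`, hence vanishes.
  let s : ℕ → ℂ := Polynomial.aeval (leftShift ℂ) q ρ
  have hs1 : ∀ k, s (k + 1) = z * s k := fun k => by
    have h1 : Polynomial.aeval (leftShift ℂ) ((Polynomial.X - Polynomial.C z) * q) ρ k = 0 := by
      rw [aeval_leftShift_apply, hpd, ← Complex.ofReal_zero, ← hf.2 k, Complex.ofReal_sum]
      refine Finset.sum_congr rfl fun i hi => ?_
      rw [hpf' i hi, Complex.ofReal_mul]
    rw [map_mul, map_sub, Polynomial.aeval_X, Polynomial.aeval_C, Module.End.mul_apply] at h1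
    exact sub_eq_zero.1 h1
  have hspow : ∀ k, s k = z ^ k * s 0 := fun k => by
    induction k with
    | zero => simp
    | succ k ih => rw [hs1, ih]; ring
  have hlim : Tendsto s atTop (𝓝 0) := by
    have hρ : Tendsto ρ atTop (𝓝 0) := by
      have := (Complex.continuous_ofReal.tendsto 0).comp (hr.comp (tendsto_add_atTop_nat 1))
      simpa [ρ, Function.comp_def] using this
    have h1 : s = fun k => ∑ i ∈ Finset.range (q.natDegree + 1), q.coeff i * ρ (k + i) :=
      funext fun k => aeval_leftShift_apply q ρ k
    rw [h1]
    have h2 := tendsto_finsetSum (Finset.range (q.natDegree + 1)) fun i _ =>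
      (hρ.comp (tendsto_add_atTop_nat i)).const_mul (q.coeff i)
    simpa using h2
  have hs0 : s 0 = 0 := by
    have h1 : ‖s 0‖ ≤ 0 := ge_of_tendsto' (by simpa using hlim.norm) fun k => by
      rw [hspow k, norm_mul, norm_pow]
      exact le_mul_of_one_le_left (norm_nonneg _) (one_le_pow₀ hz1)
    exact norm_le_zero_iff.1 h1
  -- The quotient `q` may have complex coefficients; as `r` is real, their real parts still give a
  -- recurrence, and the leading one is 1.
  refine hmin q.natDegree (by lia) (fun i => (q.coeff i).re) ⟨?_, fun k => ?_⟩
  · simp only [hq.coeff_natDegree, Complex.one_re]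
  · have h1 : s k = 0 := by rw [hspow, hs0, mul_zero]
    have h2 := congrArg Complex.re ((aeval_leftShift_apply q ρ k).symm.trans h1)
    simpa [ρ, Complex.re_sum] using h2

/-- The companion matrix acting on `(r (k + 1), …, r (k + n))`, of the recurrence with coefficients
`f 0, …, f d` shifted to order `n`. -/
def companionMatrix (n d : ℕ) (f : ℕ → ℝ) : Matrix (Fin n) (Fin n) ℝ :=
  Matrix.of fun i j =>
    if (i : ℕ) + 1 < n then if (j : ℕ) = i + 1 then 1 else 0
    else if n ≤ j + d then -f (j + d - n) else 0

/-- The ring homomorphism `φ` allows both uses: over `ℝ` on windows of `r`, where the defect of the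
last row vanishes, and over `ℂ` on eigenvectors. -/
theorem companionMatrix_mulVec {R : Type*} [CommRing R] {n d : ℕ} (hd : d ≤ n) (φ : ℝ →+* R)
    {f : ℕ → ℝ} (hf : f d = 1) (w : ℕ → R) (i : Fin n) :
    ∑ j : Fin n, φ (companionMatrix n d f i j) * w j =
      w (i + 1) - if (i : ℕ) + 1 < n then 0 else
        ∑ l ∈ Finset.range (d + 1), φ (f l) * w (l + (n - d)) := by
  by_cases hi : (i : ℕ) + 1 < n
  · simp only [companionMatrix, Matrix.of_apply, hi, if_true, sub_zero]
    rw [Finset.sum_eq_single ⟨i + 1, hi⟩]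
    · simp
    · intro j _ hj
      rw [if_neg fun h => hj (Fin.ext h), map_zero, zero_mul]
    · simp
  · simp only [companionMatrix, Matrix.of_apply, hi, if_false]
    rw [Finset.sum_range_succ, hf, map_one, one_mul, show d + (n - d) = i + 1 by lia]
    have h1 := Fin.sum_univ_eq_sum_range
      (fun j => φ (if n ≤ j + d then -f (j + d - n) else 0) * w j) n
    rw [h1]
    obtain ⟨e, rfl⟩ := Nat.exists_eq_add_of_le' hd
    rw [Finset.sum_range_add]
    have h2 : ∑ x ∈ Finset.range e, φ (if e + d ≤ x + d then -f (x + d - (e + d)) else 0) * w x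
        = 0 := Finset.sum_eq_zero fun x hx => by
      rw [if_neg (by have := Finset.mem_range.1 hx; lia), map_zero, zero_mul]
    rw [h2, zero_add, add_tsub_cancel_right, sub_add_cancel_right, ← Finset.sum_neg_distrib]
    refine Finset.sum_congr rfl fun l _ => ?_
    rw [if_pos (by lia), show e + l + d - (e + d) = l by lia, add_comm e l, map_neg, neg_mul]

/-- The shift rows force an eigenvector to be a multiple of `(1, z, z², …)`, and the last row then
gives `z ^ (n - d) * p(z) = 0`, with `p` the characteristic polynomial of the recurrence. Padding to
size `n` adds only the eigenvalue zero. -/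
theorem norm_lt_one_of_mem_spectrum_companionMatrix {r : ℕ → ℝ} (hr : Tendsto r atTop (𝓝 0))
    {n d : ℕ} (hd : d ≤ n) {f : ℕ → ℝ} (hf : IsRecurrence r d f)
    (hmin : ∀ e < d, ∀ g, ¬ IsRecurrence r e g) {z : ℂ}
    (hz : z ∈ spectrum ℂ ((companionMatrix n d f).map ((↑) : ℝ → ℂ))) : ‖z‖ < 1 := by
  rw [← Matrix.spectrum_toLin', ← Module.End.hasEigenvalue_iff_mem_spectrum] at hz
  obtain ⟨v, hv⟩ := hz.exists_hasEigenvector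
  have hev : ∀ i, ∑ j, (companionMatrix n d f i j : ℂ) * v j = z * v i := fun i => by
    simpa [Matrix.mulVec, dotProduct] using congrFun hv.apply_eq_smul i
  have hn : 0 < n := by
    by_contra! hn
    obtain rfl : n = 0 := by lia
    exact hv.2 (Subsingleton.elim _ _)
  have hpow : ∀ i (hi : i < n), v ⟨i, hi⟩ = z ^ i * v ⟨0, hn⟩ := by
    intro i
    induction i with
    | zero => intro _; simp
    | succ i ih =>
      intro hi
      have h1 := companionMatrix_mulVec hd Complex.ofRealHom hf.1
        (fun i => if h : i < n then v ⟨i, h⟩ else 0) ⟨i, by lia⟩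
      simp only [Complex.ofRealHom_eq_coe, Fin.is_lt, dite_true, Fin.eta, hev, hi, if_true,
        sub_zero] at h1
      rw [← h1, ih]
      ring
  have hv0 : v ⟨0, hn⟩ ≠ 0 := fun h => hv.2 (funext fun i => by simpa [h] using hpow i i.2)
  have hlast := companionMatrix_mulVec hd Complex.ofRealHom hf.1
    (fun i => z ^ i * v ⟨0, hn⟩) ⟨n - 1, by lia⟩
  simp only [← hpow _ (Fin.is_lt _), Complex.ofRealHom_eq_coe, Fin.eta, hev] at hlast
  rw [hpow, if_neg (by lia), ← mul_assoc, ← pow_succ', eq_comm, sub_eq_self] at hlast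
  have h2 : z ^ (n - d) * (∑ l ∈ Finset.range (d + 1), (f l : ℂ) * z ^ l) * v ⟨0, hn⟩ = 0 := by
    rw [← hlast, Finset.mul_sum, Finset.sum_mul]
    exact Finset.sum_congr rfl fun l _ => by ring
  rcases mul_eq_zero.1 ((mul_eq_zero.1 h2).resolve_right hv0) with h3 | h3
  · rw [eq_zero_of_pow_eq_zero h3, norm_zero]
    exact one_pos
  · exact norm_root_lt_one_of_isRecurrence hr hf hmin h3

/-! ### Construction of the parameters -/

theorem Matrix.dotProduct_mulVec_eq_sum {ι : Type*} [Fintype ι] (P : Matrix ι ι ℝ) (x y : ι → ℝ) :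
    x ⬝ᵥ P *ᵥ y = ∑ i, ∑ j, x i * y j * P i j := by
  simp only [dotProduct, Matrix.mulVec, Finset.mul_sum]
  exact Finset.sum_congr rfl fun i _ => Finset.sum_congr rfl fun j _ => by ring

theorem mainTheorem3 (r : ℕ → ℝ) (hr : IsCovarianceSeries r)
    (n : ℕ) (hn : (hankelMatrix r).eRank ≤ (n : ℕ∞)) :
    ∃ θ : LinearGaussianGUM n,
      θ.IsStationary ∧ θ.Realizes r ∧ (Tendsto r atTop (𝓝 0) → θ.IsStable) := by
  classical
  obtain ⟨d0, hd0, hrec⟩ := exists_isRecurrence_of_eRank_le hn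
  have hex : ∃ d, ∃ f, IsRecurrence r d f := ⟨d0, hrec⟩
  obtain ⟨d, hd, ⟨f, hf⟩, hmin⟩ : ∃ d ≤ n, (∃ f, IsRecurrence r d f) ∧
      ∀ e < d, ∀ g, ¬ IsRecurrence r e g :=
    ⟨Nat.find hex, (Nat.find_min' hex hrec).trans hd0, Nat.find_spec hex,
      fun e he g hg => Nat.find_min hex he ⟨g, hg⟩⟩
  let F := companionMatrix n d f
  let b : Fin n → ℝ := fun i => if (i : ℕ) = 0 then 1 else 0
  have hF : ∀ (k : ℕ) (i : Fin n), r (k + i + 2) = ∑ j : Fin n, F i j * r (k + j + 1) := by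
    intro k i
    have h1 := companionMatrix_mulVec hd (RingHom.id ℝ) hf.1 (fun j => r (k + j + 1)) i
    have h2 : ∑ l ∈ Finset.range (d + 1), f l * r (k + (l + (n - d)) + 1) = 0 := by
      rw [← hf.2 (k + (n - d))]
      exact Finset.sum_congr rfl fun l _ => by congr 2; ring
    simp only [RingHom.id_apply, h2, ite_self, sub_zero] at h1
    exact h1.symm
  have hb : ∀ k : ℕ, r (k + 1) = ∑ j : Fin n, b j * r (k + j + 1) := by
    intro k
    rcases Nat.eq_zero_or_pos n with rfl | hpos
    · obtain rfl : d = 0 := by lia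
      have h1 := hf.2 k
      simpa [hf.1] using h1
    · rw [Finset.sum_eq_single ⟨0, hpos⟩]
      · simp [b]
      · intro j _ hj
        have : (j : ℕ) ≠ 0 := fun h => hj (Fin.ext h)
        simp [b, this]
      · simp
  obtain ⟨P', hsymm, hpos, hform⟩ := hr.exists_stateCovariance hF hb
  let P : Matrix (Fin n) (Fin n) ℝ := Matrix.of P'
  have hPt : Pᵀ = P := Matrix.ext fun i j => hsymm j i
  let N : Fin n → ℝ := fun i => r (i + 1)
  replace hpos : ∀ u, 0 ≤ u ⬝ᵥ P *ᵥ u := fun u => by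
    rw [Matrix.dotProduct_mulVec_eq_sum]; exact hpos u
  have hcomm : ∀ x y, x ⬝ᵥ P *ᵥ y = y ⬝ᵥ P *ᵥ x := fun x y => by
    rw [Matrix.dotProduct_mulVec, ← Matrix.mulVec_transpose, hPt, dotProduct_comm]
  have hQ : ∀ (u : Fin n → ℝ) (s : ℝ), 0 ≤ u ⬝ᵥ P *ᵥ u - (u ᵥ* F) ⬝ᵥ P *ᵥ (u ᵥ* F) +
      2 * s * (u ⬝ᵥ (N - F *ᵥ P *ᵥ b)) + s ^ 2 * (r 0 - b ⬝ᵥ P *ᵥ b) := by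
    intro u s
    have h1 := hform u s
    have h2 : ∑ j, ∑ k, (∑ i, u i * F i j + s * b j) * (∑ i, u i * F i k + s * b k) * P' j k =
        (u ᵥ* F + s • b) ⬝ᵥ P *ᵥ (u ᵥ* F + s • b) :=
      (Matrix.dotProduct_mulVec_eq_sum P _ _).symm
    have h3 : ∑ i, ∑ j, u i * u j * P' i j = u ⬝ᵥ P *ᵥ u :=
      (Matrix.dotProduct_mulVec_eq_sum P _ _).symm
    have h4 : ∑ i, u i * r (i + 1) = u ⬝ᵥ N := rfl
    rw [h2, h3, h4] at h1
    simp only [Matrix.mulVec_add, Matrix.mulVec_smul, add_dotProduct, dotProduct_add,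
      smul_dotProduct, dotProduct_smul, smul_eq_mul] at h1
    rw [hcomm b] at h1
    rw [dotProduct_sub, Matrix.dotProduct_mulVec u F]
    linarith
  have hβ : 0 ≤ r 0 - b ⬝ᵥ P *ᵥ b := by simpa using hQ 0 1
  let β : ℝ≥0 := ⟨r 0 - b ⬝ᵥ P *ᵥ b, hβ⟩
  let S : Fin n → ℝ := N - F *ᵥ P *ᵥ b
  -- If `β = 0` this is zero, which is consistent: the form in `hQ` is then affine in `s` and
  -- nonnegative, so its slope `2 * S i` vanishes.
  let c : Fin n → ℝ := fun i => S i / β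
  have hc : ∀ i, β * c i = S i := by
    intro i
    rcases eq_or_ne (β : ℝ) 0 with h0 | h0
    · have h1 : ∀ s : ℝ, 0 ≤ (Pi.single i 1 ⬝ᵥ P *ᵥ Pi.single i 1 -
          (Pi.single i 1 ᵥ* F) ⬝ᵥ P *ᵥ (Pi.single i 1 ᵥ* F)) + 2 * s * S i := fun s => by
        have h2 := hQ (Pi.single i 1) s
        rw [show r 0 - b ⬝ᵥ P *ᵥ b = 0 from h0, mul_zero, add_zero] at h2
        simpa [S] using h2
      have h3 : S i = 0 := by
        by_contra h4
        set q := Pi.single i 1 ⬝ᵥ P *ᵥ Pi.single i 1 -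
          (Pi.single i 1 ᵥ* F) ⬝ᵥ P *ᵥ (Pi.single i 1 ᵥ* F)
        -- Chosen so that the affine function takes the value `-1`.
        have h5 := h1 (-(q + 1) / (2 * S i))
        have h6 : 2 * (-(q + 1) / (2 * S i)) * S i = -(q + 1) := by field_simp
        linarith
      rw [h0, zero_mul, h3]
    · exact mul_div_cancel₀ _ h0
  let α : Matrix (Fin n) (Fin n) ℝ := P - F * P * Fᵀ - (β : ℝ) • Matrix.vecMulVec c c
  have hα : α.PosSemidef := by
    refine Matrix.PosSemidef.of_dotProduct_mulVec_nonneg ?_ fun u => ?_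
    · change αᵀ = α
      simp only [α, Matrix.transpose_sub, Matrix.transpose_smul, Matrix.transpose_mul,
        Matrix.transpose_transpose, hPt, Matrix.mul_assoc, Matrix.transpose_vecMulVec]
    -- This `s` minimizes the quadratic when `β > 0`; the value is the Schur complement form `u ⬝ᵥ α
    -- *ᵥ u`.
    · have h1 := hQ u (-(u ⬝ᵥ c))
      have h2 : N - F *ᵥ P *ᵥ b = (β : ℝ) • c := funext fun i => (hc i).symm
      rw [h2, dotProduct_smul, smul_eq_mul] at h1
      have h3 : r 0 - b ⬝ᵥ P *ᵥ b = β := rfl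
      rw [h3] at h1
      have h4 : u ⬝ᵥ α *ᵥ u = u ⬝ᵥ P *ᵥ u - (u ᵥ* F) ⬝ᵥ P *ᵥ (u ᵥ* F) - β * (u ⬝ᵥ c) ^ 2 := by
        have h5 : u ⬝ᵥ (F * P * Fᵀ) *ᵥ u = (u ᵥ* F) ⬝ᵥ P *ᵥ (u ᵥ* F) := by
          rw [← Matrix.mulVec_mulVec, ← Matrix.mulVec_mulVec, Matrix.mulVec_transpose,
            Matrix.dotProduct_mulVec u F]
        have h6 : u ⬝ᵥ Matrix.vecMulVec c c *ᵥ u = (u ⬝ᵥ c) ^ 2 := by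
          rw [Matrix.vecMulVec_mulVec, dotProduct_comm c u]
          simp [sq]
        simp only [α, Matrix.sub_mulVec, Matrix.smul_mulVec, dotProduct_sub, dotProduct_smul, h5,
          h6, smul_eq_mul]
      rw [star_trivial, h4]
      linarith
  let θ : LinearGaussianGUM n :=
    { a := F - Matrix.vecMulVec c b, b := b, c := c, α := α, β := β, η := P
      posSemidef_α := hα
      posSemidef_η := Matrix.PosSemidef.of_dotProduct_mulVec_nonneg hPt fun u => hpos u }
  have ha : ∀ i j, θ.a i j + θ.c i * θ.b j = F i j := fun i j => by
    simp [θ, Matrix.vecMulVec_apply]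
  have hreal := LinearGaussianGUM.isStationary_and_realizes (θ := θ) (r := r)
    (fun i j => by
      simp only [ha]
      have h1 : (F * P * Fᵀ) i j = ∑ k, ∑ l, F j k * F i l * P k l := by
        simp only [Matrix.mul_apply, Matrix.transpose_apply, Finset.sum_mul]
        exact Finset.sum_congr rfl fun k _ => Finset.sum_congr rfl fun l _ => by
          rw [show P l k = P k l from hsymm l k]; ring
      simp [θ, α, ← h1, Matrix.vecMulVec_apply]
      ring)
    (by
      rw [← Matrix.dotProduct_mulVec_eq_sum]
      change r 0 = b ⬝ᵥ P *ᵥ b + (r 0 - b ⬝ᵥ P *ᵥ b)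
      ring)
    (fun i => by
      simp only [ha]
      have h1 := hc i
      have h2 : (F *ᵥ P *ᵥ b) i = ∑ k, ∑ l, F i k * b l * P k l :=
        Matrix.dotProduct_mulVec_eq_sum P (F i) b
      change r (i + 1) = ∑ k, ∑ l, F i k * b l * P k l + β * c i
      rw [h1, ← h2]
      simp [S, N])
    (by simpa only [ha] using hF) hb
  refine ⟨θ, hreal.1, hreal.2, fun hlim z hz => ?_⟩
  refine norm_lt_one_of_mem_spectrum_companionMatrix hlim hd hf hmin ?_
  have h1 : θ.a + Matrix.vecMulVec θ.c θ.b = F := sub_add_cancel _ _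
  rwa [h1] at hz
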